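/- Work on the unit sphere $S^2\subset\mathbb R^3$ with the geodesic distance $|ab|\in[0,\pi]$. A disk of radius $\rho\in(0,\frac{\pi}{2}]$ is the set of points at distance at most $\rho$ from a fixed point (its center); a hemisphere is a disk of radius $\frac{\pi}{2}$. A convex body is a closed set $C\subset S^2$ with non-empty interior that contains no pair of antipodes and contains, with any two points, the shorter great-circle arc joining them. A hemisphere $K$ supports $C$ if $C\subset K$ and the boundaries of $C$ and $K$ have a common point. If $K,K'$ are different and not opposite hemispheres, the thickness of the lune $K\cap K'$ is the distance between the centers of the two semicircles bounding it. For a hemisphere $K$ supporting $C$, let $\mathrm{width}_K(C)$ be the minimum of the thicknesses of the lunes $K\cap K'$ over all hemispheres $K'$ supporting $C$. The thickness $\Delta(C)$ is the smallest of the numbers $\mathrm{width}_K(C)$, and $C$ is of constant width if all these numbers are equal (then they equal $\Delta(C)$). Theorem. Let $W\subset S^2$ be a convex body of constant width with $\Delta(W)\ge\frac{\pi}{2}$. Then $W$ is contained in a disk of radius $$\Delta(W)+\arcsin\left(\frac{2\sqrt3}{3}\cdot\cos\frac{\Delta(W)}{2}\right)-\frac{\pi}{2}.$$ -/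

import Mathlib

namespace SphericalBody

/-- The unit sphere `S²` of Euclidean 3-space. Its topology (used for `interior`, `frontier`,
`IsClosed` below) is the one induced from the ambient space. -/
abbrev S2 : Type := Metric.sphere (0 : EuclideanSpace ℝ (Fin 3)) 1

/-- The spherical (geodesic) distance `|ab|`, with values in `[0, π]`: the length of the shorter
part of a great circle through `a` and `b`; it is `0` if `a = b` and `π` for antipodes. -/
noncomputable def sdist (a b : S2) : ℝ :=
  InnerProductGeometry.angle (a : EuclideanSpace ℝ (Fin 3)) (b : EuclideanSpace ℝ (Fin 3))

/-- The arc `ab` (the shorter part of the great circle through `a` and `b`, which are not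
antipodes): the points of the sphere that are nonnegative combinations of `a` and `b`. -/
def arc (a b : S2) : Set S2 :=
  {x | ∃ s t : ℝ, 0 ≤ s ∧ 0 ≤ t ∧
    (x : EuclideanSpace ℝ (Fin 3)) =
      s • (a : EuclideanSpace ℝ (Fin 3)) + t • (b : EuclideanSpace ℝ (Fin 3))}

/-- The spherical ball `B_ρ(c)`. -/
def ball (c : S2) (ρ : ℝ) : Set S2 := {x | sdist c x ≤ ρ}

/-- `D` is a disk of radius `ρ`, where a radius is a number in `(0, π/2]`. -/
def IsDisk (D : Set S2) (ρ : ℝ) : Prop :=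
  0 < ρ ∧ ρ ≤ Real.pi / 2 ∧ ∃ c : S2, D = ball c ρ

/-- The hemisphere `H(m)` with center `m`. -/
noncomputable def hemisphere (m : S2) : Set S2 := ball m (Real.pi / 2)

/-- Spherical convexity: no pair of antipodes, and closed under taking arcs. -/
def IsConvex (C : Set S2) : Prop :=
  (∀ a ∈ C, -a ∉ C) ∧ ∀ a ∈ C, ∀ b ∈ C, arc a b ⊆ C

/-- A convex body: a closed convex set with non-empty interior. -/
def IsConvexBody (C : Set S2) : Prop :=
  IsClosed C ∧ IsConvex C ∧ (interior C).Nonempty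

/-- The hemisphere `H(k)` supports `C`: it contains `C` and the boundaries meet. -/
def Supports (k : S2) (C : Set S2) : Prop :=
  C ⊆ hemisphere k ∧ (frontier C ∩ frontier (hemisphere k)).Nonempty

/-- For `G = H(g)` and `H = H(h)`, the semicircle `G/H` bounding the lune `G ∩ H`: the part of the
boundary of `G` that lies in `H`. -/
def semicircle (g h : S2) : Set S2 := frontier (hemisphere g) ∩ hemisphere h

/-- `c` is the center of the semicircle `G/H`: the point of the great circle `bd G` such that
`G/H` consists of the points of `bd G` at distance at most `π/2` from `c`. -/
def IsSemicircleCenter (g h c : S2) : Prop :=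
  c ∈ frontier (hemisphere g) ∧
    semicircle g h = {x | x ∈ frontier (hemisphere g) ∧ sdist c x ≤ Real.pi / 2}

/-- `H(g) ∩ H(h)` is a lune (the hemispheres are different and not opposite), and `t` is its
thickness: the distance between the centers of the two semicircles that bound it. -/
def IsLuneThickness (g h : S2) (t : ℝ) : Prop :=
  h ≠ g ∧ h ≠ -g ∧
    ∃ c c' : S2, IsSemicircleCenter g h c ∧ IsSemicircleCenter h g c' ∧ t = sdist c c'

/-- `width_K(C)` for `K = H(k)`: the smallest thickness of a lune `K ∩ K'`, over the hemispheres
`K'` supporting `C`. -/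
noncomputable def width (k : S2) (C : Set S2) : ℝ :=
  sInf {t | ∃ k' : S2, Supports k' C ∧ IsLuneThickness k k' t}

/-- The thickness `Δ(C)`: the smallest width of `C`, over the hemispheres supporting `C`. -/
noncomputable def thickness (C : Set S2) : ℝ :=
  sInf {w | ∃ k : S2, Supports k C ∧ w = width k C}

/-- `W` is a body of constant width: a convex body all of whose widths are equal. -/
def IsOfConstantWidth (W : Set S2) : Prop :=
  IsConvexBody W ∧ ∀ k k' : S2, Supports k W → Supports k' W → width k W = width k' W

end SphericalBody

namespace SphericalBody

-- Duality. Let `w` be the thickness and let the dual of `W` be the set of centers of hemispheres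
-- containing `W`. Supporting hemispheres are the boundary points of the dual, and the lune of `k`,
-- `k'` has thickness `π - |kk'|` (`isLuneThickness_iff`). Constant width therefore says that each
-- boundary point of the dual has farthest distance `π - w` within it.
--
-- As `w ≥ π/2`, the dual has diameter at most `π - w ≤ π/2` (`IsOfConstantWidth.neg_cos_le_inner`),
-- and `spherical_jung` puts it in a disk of center `c` and radius `r`, the arcsine in the theorem.
-- The dual is also complete: a point within `π - w` of all of it belongs to it
-- (`mem_polarCone_of_forall_le_inner`). By the triangle inequality it contains the disk of radius
-- `π - w - r` about `c`. Dualizing back (`subset_ball_of_ball_subset_polarCone`), `W` lies in the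
-- disk of radius `π/2 - (π - w - r)` about `c`.

local notation "E3" => EuclideanSpace ℝ (Fin 3)

/-! ### Hemispheres and support in terms of inner products -/

lemma norm_coe_S2 (a : S2) : ‖(a : E3)‖ = 1 := by simp

lemma inner_self_S2 (a : S2) : inner ℝ (a : E3) (a : E3) = 1 := by
  rw [real_inner_self_eq_norm_sq, norm_coe_S2]; norm_num

lemma coe_ne_zero_S2 (a : S2) : (a : E3) ≠ 0 := by
  intro h
  have := norm_coe_S2 a
  rw [h, norm_zero] at this
  exact zero_ne_one this

lemma inner_le_one_S2 (a b : S2) : inner ℝ (a : E3) (b : E3) ≤ 1 := by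
  simpa [norm_coe_S2] using real_inner_le_norm (a : E3) (b : E3)

lemma neg_one_le_inner_S2 (a b : S2) : -1 ≤ inner ℝ (a : E3) (b : E3) := by
  have := (abs_le.1 (abs_real_inner_le_norm (a : E3) (b : E3))).1
  simpa [norm_coe_S2] using this

lemma sdist_eq_arccos (a b : S2) : sdist a b = Real.arccos (inner ℝ (a : E3) (b : E3)) := by
  simp [sdist, InnerProductGeometry.angle]

lemma sdist_le_pi_div_two_iff (a b : S2) :
    sdist a b ≤ Real.pi / 2 ↔ 0 ≤ inner ℝ (a : E3) (b : E3) := by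
  rw [sdist_eq_arccos, Real.arccos_le_pi_div_two]

lemma mem_hemisphere {m x : S2} : x ∈ hemisphere m ↔ 0 ≤ inner ℝ (m : E3) (x : E3) :=
  sdist_le_pi_div_two_iff m x

lemma isClosed_hemisphere (m : S2) : IsClosed (hemisphere m) := by
  have : hemisphere m = {x : S2 | 0 ≤ inner ℝ (m : E3) (x : E3)} := by
    ext x; exact mem_hemisphere
  rw [this]
  exact isClosed_le continuous_const (by fun_prop)

/-- The point of the great circle through orthogonal points `x` and `m` at angle `t` from `x`,
in the direction opposite to `m`. -/
noncomputable def rotateAway (x m : S2) (h : inner ℝ (m : E3) (x : E3) = 0) (t : ℝ) : S2 :=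
  ⟨Real.cos t • (x : E3) - Real.sin t • (m : E3), by
    have h' : inner ℝ (x : E3) (m : E3) = 0 := by rw [real_inner_comm]; exact h
    rw [mem_sphere_zero_iff_norm, ← sq_eq_sq₀ (norm_nonneg _) zero_le_one,
      ← real_inner_self_eq_norm_sq]
    simp only [inner_sub_left, inner_sub_right, inner_smul_left, inner_smul_right, inner_self_S2,
      h, h', RCLike.conj_to_real]
    nlinarith [Real.sin_sq_add_cos_sq t]⟩

lemma notMem_interior_hemisphere {m x : S2} (h : inner ℝ (m : E3) (x : E3) = 0) :
    x ∉ interior (hemisphere m) := by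
  intro hx
  have hc : Continuous (rotateAway x m h) := by
    unfold rotateAway
    fun_prop
  have h0 : rotateAway x m h 0 = x := by
    ext1; simp [rotateAway]
  have hev : ∀ᶠ t in nhds (0 : ℝ), rotateAway x m h t ∈ interior (hemisphere m) := by
    refine hc.continuousAt.eventually_mem ?_
    rw [h0]
    exact isOpen_interior.mem_nhds hx
  obtain ⟨ε, hε, hball⟩ := Metric.eventually_nhds_iff.1 hev
  set t := min (ε / 2) 1 with ht
  have ht0 : 0 < t := by positivity
  have h1 := mem_hemisphere.1 (interior_subset (@hball t (by
    rw [Real.dist_eq, sub_zero, abs_of_pos ht0]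
    have := min_le_left (ε / 2) 1
    linarith)))
  have hsin : 0 < Real.sin t := Real.sin_pos_of_pos_of_lt_pi ht0 (by
    have := min_le_right (ε / 2) 1
    have := Real.pi_gt_three
    linarith)
  simp only [rotateAway, inner_sub_right, inner_smul_right, inner_self_S2, h] at h1
  linarith

lemma mem_frontier_hemisphere {m x : S2} :
    x ∈ frontier (hemisphere m) ↔ inner ℝ (m : E3) (x : E3) = 0 := by
  constructor
  · intro hx
    have heq : hemisphere m = {x : S2 | (fun _ => (0 : ℝ)) x ≤ inner ℝ (m : E3) (x : E3)} := by
      ext x; exact mem_hemisphere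
    rw [heq] at hx
    exact (frontier_le_subset_eq continuous_const (by fun_prop) hx).symm
  · intro h
    rw [(isClosed_hemisphere m).frontier_eq]
    exact ⟨mem_hemisphere.2 h.ge, notMem_interior_hemisphere h⟩

/-- A point of `C` on the bounding great circle is automatically in the frontier of `C`, since it is
not interior to the larger hemisphere. -/
lemma supports_iff {k : S2} {C : Set S2} (hC : IsClosed C) :
    Supports k C ↔ (∀ x ∈ C, 0 ≤ inner ℝ (k : E3) (x : E3)) ∧
      ∃ x ∈ C, inner ℝ (k : E3) (x : E3) = 0 := by
  constructor
  · rintro ⟨h, x, hx, hx'⟩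
    exact ⟨fun y hy => mem_hemisphere.1 (h hy), x, hC.frontier_subset hx,
      mem_frontier_hemisphere.1 hx'⟩
  · rintro ⟨h, x, hx, hx'⟩
    have hsub : C ⊆ hemisphere k := fun y hy => mem_hemisphere.2 (h y hy)
    refine ⟨hsub, x, ?_, mem_frontier_hemisphere.2 hx'⟩
    rw [hC.frontier_eq]
    exact ⟨hx, fun hi => notMem_interior_hemisphere hx' (interior_mono hsub hi)⟩

/-! ### Thickness of lunes -/

lemma mem_semicircle {g h x : S2} :
    x ∈ semicircle g h ↔ inner ℝ (g : E3) (x : E3) = 0 ∧ 0 ≤ inner ℝ (h : E3) (x : E3) := by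
  rw [semicircle, Set.mem_inter_iff, mem_frontier_hemisphere, mem_hemisphere]

lemma inner_sq_lt_one {g h : S2} (h1 : h ≠ g) (h2 : h ≠ -g) :
    0 < 1 - inner ℝ (g : E3) (h : E3) ^ 2 := by
  have ha : inner ℝ (g : E3) (h : E3) ≠ 1 := fun h' => h1 (Subtype.ext
    ((inner_eq_one_iff_of_norm_eq_one (norm_coe_S2 g) (norm_coe_S2 h)).1 h').symm)
  have hb : inner ℝ (g : E3) (h : E3) ≠ -1 := by
    intro h'
    have : inner ℝ (h : E3) ((-g : S2) : E3) = 1 := by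
      rw [real_inner_comm, show ((-g : S2) : E3) = -(g : E3) from rfl, inner_neg_left, h', neg_neg]
    exact h2 (Subtype.ext
      ((inner_eq_one_iff_of_norm_eq_one (norm_coe_S2 h) (norm_coe_S2 (-g))).1 this))
  have ha' := lt_of_le_of_ne (inner_le_one_S2 g h) ha
  have hb' := lt_of_le_of_ne (neg_one_le_inner_S2 g h) hb.symm
  nlinarith

/-- If `c ≠ n`, the direction of `n - c` lies on the great circle, makes an acute angle with `n` and
an obtuse one with `c`. -/
lemma eq_of_same_semicircle {g c n : S2} (hc : inner ℝ (g : E3) (c : E3) = 0)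
    (hn : inner ℝ (g : E3) (n : E3) = 0)
    (h : ∀ x : S2, inner ℝ (g : E3) (x : E3) = 0 → 0 ≤ inner ℝ (n : E3) (x : E3) →
      0 ≤ inner ℝ (c : E3) (x : E3)) : c = n := by
  by_contra hne
  have hlt : inner ℝ (c : E3) (n : E3) < 1 := lt_of_le_of_ne (inner_le_one_S2 c n) fun h' =>
    hne (Subtype.ext ((inner_eq_one_iff_of_norm_eq_one (norm_coe_S2 c) (norm_coe_S2 n)).1 h'))
  have hy : (n : E3) - c ≠ 0 := fun h' => hne (Subtype.ext (sub_eq_zero.1 h').symm)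
  have hy' : 0 < ‖(n : E3) - c‖⁻¹ := inv_pos.2 (norm_pos_iff.2 hy)
  have := h ⟨‖(n : E3) - c‖⁻¹ • ((n : E3) - c), by
    rw [mem_sphere_zero_iff_norm]; exact norm_smul_inv_norm hy⟩
    (by simp [inner_smul_right, inner_sub_right, hc, hn])
    (by
      simp only [inner_smul_right, inner_sub_right, inner_self_S2]
      rw [real_inner_comm]
      exact mul_nonneg hy'.le (by linarith))
  simp only [inner_smul_right, inner_sub_right, inner_self_S2] at this
  nlinarith

/-- The unit vector orthogonal to `g` in the direction of the projection of `h`. -/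
noncomputable def normalizedProj (g h : S2) (h1 : h ≠ g) (h2 : h ≠ -g) : S2 :=
  ⟨(√(1 - inner ℝ (g : E3) (h : E3) ^ 2))⁻¹ •
      ((h : E3) - inner ℝ (g : E3) (h : E3) • (g : E3)), by
    have hpos := inner_sq_lt_one h1 h2
    rw [mem_sphere_zero_iff_norm, ← sq_eq_sq₀ (norm_nonneg _) zero_le_one,
      ← real_inner_self_eq_norm_sq]
    simp only [inner_sub_left, inner_sub_right, inner_smul_left, inner_smul_right, inner_self_S2,
      RCLike.conj_to_real, real_inner_comm (g : E3) (h : E3)]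
    have hs := Real.sq_sqrt hpos.le
    have hs0 := (Real.sqrt_pos.2 hpos).ne'
    field_simp
    rw [hs]; ring⟩

lemma inner_normalizedProj_self {g h : S2} (h1 : h ≠ g) (h2 : h ≠ -g) :
    inner ℝ (g : E3) (normalizedProj g h h1 h2 : E3) = 0 := by
  simp [normalizedProj, inner_smul_right, inner_sub_right]

lemma isSemicircleCenter_normalizedProj {g h : S2} (h1 : h ≠ g) (h2 : h ≠ -g) :
    IsSemicircleCenter g h (normalizedProj g h h1 h2) := by
  refine ⟨mem_frontier_hemisphere.2 (inner_normalizedProj_self h1 h2), ?_⟩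
  ext x
  rw [mem_semicircle, Set.mem_ofPred_eq, mem_frontier_hemisphere, sdist_le_pi_div_two_iff]
  refine and_congr_right fun hx => ?_
  have hpos := inv_pos.2 (Real.sqrt_pos.2 (inner_sq_lt_one h1 h2))
  simp only [normalizedProj, inner_smul_left, inner_sub_left, hx, RCLike.conj_to_real, mul_zero,
    sub_zero]
  exact (mul_nonneg_iff_of_pos_left hpos).symm

lemma IsSemicircleCenter.eq_normalizedProj {g h c : S2} (h1 : h ≠ g) (h2 : h ≠ -g)
    (hc : IsSemicircleCenter g h c) : c = normalizedProj g h h1 h2 := by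
  refine eq_of_same_semicircle (mem_frontier_hemisphere.1 hc.1)
    (inner_normalizedProj_self h1 h2) fun x hx hx' => ?_
  have hmem : x ∈ semicircle g h := by
    rw [(isSemicircleCenter_normalizedProj h1 h2).2]
    exact ⟨mem_frontier_hemisphere.2 hx, (sdist_le_pi_div_two_iff _ _).2 hx'⟩
  rw [hc.2] at hmem
  exact (sdist_le_pi_div_two_iff _ _).1 hmem.2

lemma sdist_normalizedProj {g h : S2} (h1 : h ≠ g) (h2 : h ≠ -g) (h3 : g ≠ h) (h4 : g ≠ -h) :
    sdist (normalizedProj g h h1 h2) (normalizedProj h g h3 h4) = Real.pi - sdist g h := by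
  rw [sdist_eq_arccos, sdist_eq_arccos, ← Real.arccos_neg]
  congr 1
  have hpos := inner_sq_lt_one h1 h2
  simp only [normalizedProj, inner_sub_left, inner_sub_right, inner_smul_left, inner_smul_right,
    inner_self_S2, RCLike.conj_to_real, real_inner_comm (g : E3) (h : E3)]
  have hs := Real.sq_sqrt hpos.le
  have hs0 := (Real.sqrt_pos.2 hpos).ne'
  field_simp
  rw [hs]; ring

lemma isLuneThickness_iff {g h : S2} {t : ℝ} :
    IsLuneThickness g h t ↔ h ≠ g ∧ h ≠ -g ∧ t = Real.pi - sdist g h := by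
  constructor
  · rintro ⟨h1, h2, c, c', hc, hc', rfl⟩
    have h4 : g ≠ -h := fun h' => h2 (by rw [h', neg_neg])
    rw [hc.eq_normalizedProj h1 h2, hc'.eq_normalizedProj h1.symm h4, sdist_normalizedProj]
    exact ⟨h1, h2, rfl⟩
  · rintro ⟨h1, h2, rfl⟩
    have h4 : g ≠ -h := fun h' => h2 (by rw [h', neg_neg])
    exact ⟨h1, h2, _, _, isSemicircleCenter_normalizedProj h1 h2,
      isSemicircleCenter_normalizedProj h1.symm h4, (sdist_normalizedProj h1 h2 _ _).symm⟩

/-! ### Compactness of convex hulls and Jung's theorem -/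

open Module in
-- Carathéodory: the hull is a continuous image of a simplex times a power of `s`.
lemma isCompact_convexHull_of_finiteDimensional {E : Type*} [NormedAddCommGroup E]
    [NormedSpace ℝ E] [FiniteDimensional ℝ E] {s : Set E} (hs : IsCompact s) :
    IsCompact (convexHull ℝ s) := by
  rcases s.eq_empty_or_nonempty with rfl | ⟨x₀, hx₀⟩
  · simp
  let N := finrank ℝ E + 1
  let F : (Fin N → ℝ) × (Fin N → E) → E := fun p => ∑ i, p.1 i • p.2 i
  have hF : Continuous F := by fun_prop
  have hK : IsCompact (stdSimplex ℝ (Fin N) ×ˢ Set.univ.pi fun _ : Fin N => s) :=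
    (isCompact_stdSimplex ℝ _).prod (isCompact_univ_pi fun _ => hs)
  convert hK.image hF using 1
  ext x
  constructor
  · intro hx
    obtain ⟨ι, _, z, w, hz, hind, hw, hsum, rfl⟩ := eq_pos_convex_span_of_mem_convexHull hx
    have hcard : Fintype.card ι ≤ Fintype.card (Fin N) := by
      rw [Fintype.card_fin]
      exact hind.card_le_finrank_succ.trans
        (Nat.add_le_add_right (Submodule.finrank_le _) 1)
    obtain ⟨e⟩ := Function.Embedding.nonempty_of_card_le hcard
    have hext : ∀ i, Function.extend e w 0 (e i) = w i := fun i => e.injective.extend_apply _ _ i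
    have hext0 : ∀ j, j ∉ Set.range e → Function.extend e w 0 j = 0 :=
      fun j hj => Function.extend_apply' _ _ _ fun ⟨i, hi⟩ => hj ⟨i, hi⟩
    -- Pad to exactly `N` points, with weight `0` at `x₀`.
    refine ⟨(Function.extend e w 0, Function.extend e z fun _ => x₀), ⟨⟨fun j => ?_, ?_⟩, ?_⟩, ?_⟩
    · by_cases hj : j ∈ Set.range e
      · obtain ⟨i, rfl⟩ := hj
        simpa only [hext] using (hw i).le
      · exact (hext0 j hj).ge
    · rw [← hsum]
      exact (Fintype.sum_of_injective e e.injective _ _ hext0 fun i => (hext i).symm).symm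
    · intro j _
      by_cases hj : j ∈ Set.range e
      · obtain ⟨i, rfl⟩ := hj
        simpa only [e.injective.extend_apply] using hz ⟨i, rfl⟩
      · simpa only [Function.extend_apply' _ _ _ fun ⟨i, hi⟩ => hj ⟨i, hi⟩] using hx₀
    · refine (Fintype.sum_of_injective e e.injective _ _ (fun j hj => ?_) fun i => ?_).symm
      · simp only [hext0 j hj, zero_smul]
      · simp only [e.injective.extend_apply]
  · rintro ⟨⟨w, z⟩, ⟨hw, hz⟩, rfl⟩
    exact (convex_convexHull ℝ s).sum_mem (fun i _ => hw.1 i) hw.2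
      fun i _ => subset_convexHull ℝ s (hz i (Set.mem_univ i))

/-- **Jung's theorem** for a compact set `A` on the sphere, in terms of cosines: if the points of
`A` have pairwise distances at most `arccos κ ≤ π / 2`, then `A` lies in a disk of radius
`arccos √((1 + 2κ) / 3)`. -/
theorem spherical_jung {A : Set S2} (hA : IsClosed A) (hne : A.Nonempty) {κ : ℝ} (hκ : 0 ≤ κ)
    (hdist : ∀ x ∈ A, ∀ y ∈ A, κ ≤ inner ℝ (x : E3) (y : E3)) :
    ∃ c : S2, ∀ x ∈ A, √((1 + 2 * κ) / 3) ≤ inner ℝ (c : E3) (x : E3) := by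
  classical
  set s : Set E3 := (↑) '' A with hs
  have hscomp : IsCompact s := hA.isCompact.image continuous_subtype_val
  obtain ⟨x₀, hx₀⟩ := hne
  have hκ1 : κ ≤ 1 := (hdist x₀ hx₀ x₀ hx₀).trans_eq (inner_self_S2 x₀)
  have hHc : IsCompact (convexHull ℝ s) := isCompact_convexHull_of_finiteDimensional hscomp
  -- `h` is the point of the hull nearest the origin; its direction will be the center.
  obtain ⟨h, hh, hmin⟩ := exists_norm_eq_iInf_of_complete_convex
    (⟨x₀, subset_convexHull ℝ s ⟨x₀, hx₀, rfl⟩⟩ : (convexHull ℝ s).Nonempty)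
    hHc.isComplete (convex_convexHull ℝ s) 0
  rw [norm_eq_iInf_iff_real_inner_le_zero (convex_convexHull ℝ s) hh] at hmin
  have hsup : ∀ y ∈ s, ‖h‖ ^ 2 ≤ inner ℝ h y := by
    intro y hy
    have := hmin y (subset_convexHull ℝ s hy)
    rw [zero_sub, inner_neg_left, inner_sub_right, real_inner_self_eq_norm_sq] at this
    linarith
  obtain ⟨ι, _, z, w, hz, hind, hw, hsum, hzw⟩ := eq_pos_convex_span_of_mem_convexHull hh
  have hzs : ∀ i, z i ∈ s := fun i => hz ⟨i, rfl⟩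
  have hzz : ∀ i j, κ + (if i = j then 1 - κ else 0) ≤ inner ℝ (z i) (z j) := by
    intro i j
    obtain ⟨a, ha, hai⟩ := hzs i
    obtain ⟨b, hb, hbj⟩ := hzs j
    split_ifs with hij
    · rw [← hij, ← hai, inner_self_S2]; linarith
    · rw [← hai, ← hbj, add_zero]; exact hdist a ha b hb
  have hnorm : κ + (1 - κ) * ∑ i, w i ^ 2 ≤ ‖h‖ ^ 2 := by
    rw [← real_inner_self_eq_norm_sq, ← hzw]
    simp only [sum_inner, inner_sum, inner_smul_left, inner_smul_right, RCLike.conj_to_real]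
    calc κ + (1 - κ) * ∑ i, w i ^ 2
        = ∑ i, ∑ j, w i * (w j * (κ + if i = j then 1 - κ else 0)) := by
          simp only [mul_add, Finset.sum_add_distrib, ← Finset.mul_sum, ← Finset.sum_mul, hsum,
            mul_ite, mul_zero, Finset.sum_ite_eq, Finset.mem_univ, if_true]
          rw [one_mul, one_mul, Finset.mul_sum]
          congr 1
          exact Finset.sum_congr rfl fun i _ => by ring
      _ ≤ _ := by
          refine Finset.sum_le_sum fun i _ => ?_
          rw [Finset.mul_sum]
          refine Finset.sum_le_sum fun j _ => ?_
          rw [← mul_assoc, ← mul_assoc, real_inner_comm]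
          exact mul_le_mul_of_nonneg_left (hzz i j) (mul_nonneg (hw i).le (hw j).le)
  have hcs : (1 : ℝ) ≤ Fintype.card ι * ∑ i, w i ^ 2 := by
    have := sq_sum_le_card_mul_sum_sq (s := Finset.univ) (f := w)
    rwa [hsum, one_pow, Finset.card_univ] at this
  have hsq : 0 < ∑ i, w i ^ 2 := by
    by_contra hcon
    have : (Fintype.card ι : ℝ) * ∑ i, w i ^ 2 ≤ 0 :=
      mul_nonpos_of_nonneg_of_nonpos (Nat.cast_nonneg _) (not_lt.1 hcon)
    linarith
  have hpos : 0 < ‖h‖ ^ 2 := by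
    rcases hκ.eq_or_lt with h0 | h0
    · rw [← h0] at hnorm; linarith
    · nlinarith
  -- The differences are nonnegative and their mean with positive weights is zero, so each vanishes.
  have hin : ∀ i, inner ℝ h (z i) = ‖h‖ ^ 2 := by
    have htot : ∑ i, w i * (inner ℝ h (z i) - ‖h‖ ^ 2) = 0 := by
      simp only [mul_sub, Finset.sum_sub_distrib, ← Finset.sum_mul, hsum, one_mul]
      rw [← real_inner_self_eq_norm_sq, sub_eq_zero]
      conv_rhs => rw [← hzw, inner_sum]
      simp only [inner_smul_right, hzw]
    intro i
    have := (Finset.sum_eq_zero_iff_of_nonneg fun j _ =>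
      mul_nonneg (hw j).le (sub_nonneg.2 (hsup _ (hzs j)))).1 htot i (Finset.mem_univ i)
    rcases mul_eq_zero.1 this with h' | h'
    · exact absurd h' (hw i).ne'
    · linarith
  -- The `z i` are affinely independent in a plane missing the origin, hence linearly independent:
  -- at most three points, not Carathéodory's four, which gives the constant `1 / 3`.
  have hlin : LinearIndependent ℝ z := by
    rw [Fintype.linearIndependent_iff]
    intro g hg i
    refine affineIndependent_iff.1 hind Finset.univ g ?_ hg i (Finset.mem_univ i)
    have : inner ℝ h (∑ i, g i • z i) = (∑ i, g i) * ‖h‖ ^ 2 := by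
      simp only [inner_sum, inner_smul_right, hin, Finset.sum_mul]
    rw [hg, inner_zero_right] at this
    exact (mul_eq_zero.1 this.symm).resolve_right hpos.ne'
  have hcard : (Fintype.card ι : ℝ) ≤ 3 := by
    have := hlin.fintype_card_le_finrank
    rw [finrank_euclideanSpace_fin] at this
    exact_mod_cast this
  have hthird : 1 / 3 ≤ ∑ i, w i ^ 2 := by nlinarith
  have hlow : (1 + 2 * κ) / 3 ≤ ‖h‖ ^ 2 := by nlinarith
  have hh0 : 0 < ‖h‖ := by
    rcases (norm_nonneg h).eq_or_lt with h' | h'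
    · rw [← h'] at hpos; norm_num at hpos
    · exact h'
  refine ⟨⟨‖h‖⁻¹ • h, by
    rw [mem_sphere_zero_iff_norm]; exact norm_smul_inv_norm (norm_pos_iff.1 hh0)⟩, fun x hx => ?_⟩
  calc √((1 + 2 * κ) / 3) ≤ ‖h‖ := Real.sqrt_le_iff.2 ⟨hh0.le, hlow⟩
    _ = ‖h‖⁻¹ * ‖h‖ ^ 2 := by field_simp
    _ ≤ ‖h‖⁻¹ * inner ℝ h x :=
        mul_le_mul_of_nonneg_left (hsup x ⟨x, hx, rfl⟩) (inv_nonneg.2 hh0.le)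
    _ = _ := by simp [inner_smul_left]

/-! ### The dual cone and its completeness -/

/-- The dual cone of a subset of the sphere; its unit vectors are the centers of the hemispheres
that contain the set. -/
def polarCone (C : Set S2) : Set (EuclideanSpace ℝ (Fin 3)) :=
  {v | ∀ x ∈ C, 0 ≤ inner ℝ v (x : E3)}

lemma exists_pos_le_inner {C : Set S2} (hC : IsCompact C) {v : E3}
    (h : ∀ x ∈ C, 0 < inner ℝ v (x : E3)) : ∃ ε > 0, ∀ x ∈ C, ε ≤ inner ℝ v (x : E3) := by
  rcases C.eq_empty_or_nonempty with rfl | hne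
  · exact ⟨1, one_pos, by simp⟩
  · obtain ⟨x, hx, hmin⟩ := hC.exists_isMinOn hne
      (f := fun x : S2 => inner ℝ v (x : E3)) (by fun_prop)
    exact ⟨_, h x hx, fun y hy => hmin hy⟩

/-- A segment that leaves the dual cone meets its boundary. -/
lemma exists_boundary_of_notMem_polarCone {C : Set S2} (hC : IsCompact C) {z p : E3}
    (hz : z ∈ polarCone C) (hp : p ∉ polarCone C) :
    ∃ t : ℝ, 0 ≤ t ∧ t < 1 ∧ z + t • (p - z) ∈ polarCone C ∧
      ∃ x ∈ C, inner ℝ (z + t • (p - z)) (x : E3) = 0 := by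
  have hclosed : IsClosed (polarCone C) := by
    have : polarCone C = ⋂ x ∈ C, {v : E3 | 0 ≤ inner ℝ v (x : E3)} := by
      ext v; simp [polarCone]
    rw [this]
    exact isClosed_biInter fun x _ => isClosed_le continuous_const (by fun_prop)
  have hS : IsCompact (Set.Icc (0 : ℝ) 1 ∩ (fun t : ℝ => z + t • (p - z)) ⁻¹' polarCone C) :=
    isCompact_Icc.inter_right (hclosed.preimage (by fun_prop))
  obtain ⟨t, ⟨⟨ht0, ht1⟩, htP⟩, htop⟩ := hS.exists_isGreatest ⟨0, by simp, by simpa using hz⟩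
  have htP' : z + t • (p - z) ∈ polarCone C := htP
  have hlt : t < 1 := lt_of_le_of_ne ht1 fun h => hp (by simpa [h] using htP')
  refine ⟨t, ht0, hlt, htP', ?_⟩
  by_contra! hcon
  obtain ⟨ε, hε, hle⟩ := exists_pos_le_inner hC fun x hx =>
    lt_of_le_of_ne (htP' x hx) (hcon x hx).symm
  -- A step short enough to stay in the cone, against the maximality of `t`.
  set s := min (1 - t) (ε / (‖p - z‖ + 1)) with hs
  have hN : 0 < ‖p - z‖ + 1 := by positivity
  have hs0 : 0 < s := lt_min (by linarith) (by positivity)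
  have hs1 : s ≤ 1 - t := min_le_left _ _
  have hs2 : s * (‖p - z‖ + 1) ≤ ε := (le_div_iff₀ hN).1 (min_le_right _ _)
  have : t + s ≤ t := htop ⟨⟨by linarith, by linarith⟩, fun x hx => by
    have h1 := hle x hx
    have h2 : -‖p - z‖ ≤ inner ℝ (p - z) (x : E3) := by
      have := (abs_le.1 (abs_real_inner_le_norm (p - z) (x : E3))).1
      simpa [norm_coe_S2] using this
    have h3 : inner ℝ (z + (t + s) • (p - z)) (x : E3)
        = inner ℝ (z + t • (p - z)) (x : E3) + s * inner ℝ (p - z) (x : E3) := by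
      rw [add_smul, ← add_assoc, inner_add_left, inner_smul_left]; rfl
    rw [h3]
    nlinarith⟩
  linarith

/-- A compact convex subset of the sphere lies in an open hemisphere. -/
lemma IsConvex.exists_inner_pos {C : Set S2} (hC : IsCompact C) (hconv : IsConvex C) :
    ∃ z : E3, ∀ x ∈ C, 0 < inner ℝ z (x : E3) := by
  set s : Set E3 := (↑) '' C with hs
  -- The cone over `C` without its apex. It is convex because `C` has no antipodes, so the hull of
  -- `C` misses the origin and can be separated from it.
  set K : Set E3 := {v | ∃ r > (0 : ℝ), ∃ x ∈ C, v = r • (x : E3)} with hK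
  have hKconv : Convex ℝ K := by
    rw [convex_iff_forall_pos]
    rintro _ ⟨r, hr, x, hx, rfl⟩ _ ⟨q, hq, y, hy, rfl⟩ a b ha hb -
    rw [smul_smul, smul_smul]
    set v : E3 := (a * r) • (x : E3) + (b * q) • (y : E3) with hv
    have har := mul_pos ha hr
    have hbq := mul_pos hb hq
    have hv0 : v ≠ 0 := by
      intro h0
      have hxy : (x : E3) = -(y : E3) := by
        have h1 : (a * r) • (x : E3) = -((b * q) • (y : E3)) := eq_neg_of_add_eq_zero_left h0
        have h2 := congrArg norm h1
        rw [norm_neg, norm_smul, norm_smul, norm_coe_S2, norm_coe_S2, mul_one, mul_one,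
          Real.norm_of_nonneg har.le, Real.norm_of_nonneg hbq.le] at h2
        rw [← h2, ← smul_neg] at h1
        exact smul_right_injective _ har.ne' h1
      exact hconv.1 y hy (by
        have : x = -y := Subtype.ext hxy
        rwa [← this])
    have hn := norm_pos_iff.2 hv0
    refine ⟨‖v‖, hn, ⟨‖v‖⁻¹ • v, by
      rw [mem_sphere_zero_iff_norm]; exact norm_smul_inv_norm hv0⟩, ?_, ?_⟩
    · refine hconv.2 x hx y hy ⟨‖v‖⁻¹ * (a * r), ‖v‖⁻¹ * (b * q), by positivity, by positivity, ?_⟩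
      simp only [hv, smul_add, smul_smul]
    · simp only [smul_smul, mul_inv_cancel₀ hn.ne', one_smul]
  have hsub : convexHull ℝ s ⊆ K := convexHull_min (by
    rintro _ ⟨x, hx, rfl⟩
    exact ⟨1, one_pos, x, hx, by simp⟩) hKconv
  have h0 : (0 : E3) ∉ convexHull ℝ s := by
    intro h
    obtain ⟨r, hr, x, -, hx⟩ := hsub h
    rcases smul_eq_zero.1 hx.symm with h' | h'
    · exact hr.ne' h'
    · exact coe_ne_zero_S2 x h'
  have hcomp : IsCompact (convexHull ℝ s) :=
    isCompact_convexHull_of_finiteDimensional (hC.image continuous_subtype_val)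
  obtain ⟨f, u, hf0, hf⟩ := geometric_hahn_banach_point_closed (convex_convexHull ℝ s)
    hcomp.isClosed h0
  refine ⟨(InnerProductSpace.toDual ℝ E3).symm f, fun x hx => ?_⟩
  rw [InnerProductSpace.toDual_symm_apply]
  rw [map_zero] at hf0
  exact hf0.trans (hf x (subset_convexHull ℝ s ⟨x, hx, rfl⟩))

/-- A lower bound for the inner product with `x₀` on the boundary of the dual cone extends to the
whole dual cone. -/
lemma mul_norm_le_inner_of_boundary {C : Set S2} (hC : IsCompact C) {κ : ℝ} (hκ0 : 0 ≤ κ)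
    (hκ1 : κ ≤ 1) {x₀ : S2} (hx₀ : ∃ y ∈ C, 0 < inner ℝ (x₀ : E3) (y : E3))
    (h : ∀ a ∈ polarCone C, (∃ x ∈ C, inner ℝ a (x : E3) = 0) →
      κ * ‖a‖ ≤ inner ℝ a (x₀ : E3)) {z : E3} (hz : z ∈ polarCone C) :
    κ * ‖z‖ ≤ inner ℝ z (x₀ : E3) := by
  obtain ⟨y, hy, hpos⟩ := hx₀
  -- Chosen so that `z - T • x₀` has inner product `-1` with `y`: going from `z` along `-x₀` leaves
  -- the cone, at a boundary point `a`.
  set T := (inner ℝ z (y : E3) + 1) / inner ℝ (x₀ : E3) (y : E3) with hT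
  have hT0 : 0 ≤ T := div_nonneg (by linarith [hz y hy]) hpos.le
  have hp : z - T • (x₀ : E3) ∉ polarCone C := by
    intro hmem
    have h1 := hmem y hy
    have h2 : T * inner ℝ (x₀ : E3) (y : E3) = inner ℝ z (y : E3) + 1 :=
      div_mul_cancel₀ _ hpos.ne'
    rw [inner_sub_left, inner_smul_left, RCLike.conj_to_real, h2] at h1
    linarith
  obtain ⟨t, ht0, -, hmem, hbd⟩ := exists_boundary_of_notMem_polarCone hC hz hp
  have ha := h _ hmem hbd
  set a := z + t • (z - T • (x₀ : E3) - z) with ha'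
  have hza : z = a + (t * T) • (x₀ : E3) := by
    rw [ha', sub_sub_cancel_left, smul_neg, smul_smul, neg_add_cancel_right]
  have htT := mul_nonneg ht0 hT0
  have hn : ‖z‖ ≤ ‖a‖ + t * T := by
    calc ‖z‖ = ‖a + (t * T) • (x₀ : E3)‖ := by rw [← hza]
      _ ≤ ‖a‖ + ‖(t * T) • (x₀ : E3)‖ := norm_add_le _ _
      _ = _ := by rw [norm_smul, norm_coe_S2, mul_one, Real.norm_of_nonneg htT]
  have hi : inner ℝ z (x₀ : E3) = inner ℝ a (x₀ : E3) + t * T := by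
    rw [hza, inner_add_left, inner_smul_left, inner_self_S2, mul_one]; rfl
  rw [hi]
  nlinarith [mul_le_mul_of_nonneg_left hn hκ0, mul_le_mul_of_nonneg_right hκ1 htT]

/-- The dual of a body of constant width is complete: if no point of it is farther than
`arccos κ` from `p`, then `p` belongs to it. -/
lemma mem_polarCone_of_forall_le_inner {C : Set S2} (hC : IsCompact C) (hconv : IsConvex C)
    (hne : C.Nonempty) {κ : ℝ} (hκ0 : 0 ≤ κ) (hκ1 : κ < 1)
    (hdiam : ∀ x y : S2, (x : E3) ∈ polarCone C → (y : E3) ∈ polarCone C →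
      κ ≤ inner ℝ (x : E3) (y : E3))
    (hbd : ∀ q : S2, (q : E3) ∈ polarCone C → (∃ x ∈ C, inner ℝ (q : E3) (x : E3) = 0) →
      ∃ b : S2, (b : E3) ∈ polarCone C ∧ inner ℝ (q : E3) (b : E3) ≤ κ)
    {p : S2} (hp : ∀ x : S2, (x : E3) ∈ polarCone C → κ ≤ inner ℝ (p : E3) (x : E3)) :
    (p : E3) ∈ polarCone C := by
  have hunit : ∀ (v : E3) (hv : v ≠ 0) (b : S2), v ∈ polarCone C → (b : E3) ∈ polarCone C →
      κ * ‖v‖ ≤ inner ℝ v (b : E3) := by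
    intro v hv b hvP hb
    have hn := norm_pos_iff.2 hv
    have := hdiam ⟨‖v‖⁻¹ • v, by rw [mem_sphere_zero_iff_norm]; exact norm_smul_inv_norm hv⟩ b
      (fun x hx => by
        simp only [inner_smul_left]
        exact mul_nonneg (inv_nonneg.2 hn.le) (hvP x hx)) hb
    simp only [inner_smul_left, RCLike.conj_to_real] at this
    rwa [inv_mul_eq_div, le_div_iff₀ hn] at this
  obtain ⟨z, hz⟩ := hconv.exists_inner_pos hC
  obtain ⟨x₁, hx₁⟩ := hne
  obtain ⟨ε, hε, hle⟩ := exists_pos_le_inner hC hz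
  have hzP : z ∈ polarCone C := fun x hx => (hz x hx).le
  have hz0 : z ≠ 0 := by
    rintro rfl
    simpa using hz x₁ hx₁
  -- `z` is interior to the cone, so it can be pushed away from `b` by `δ`. The diameter bound there
  -- gains `δ * (1 - κ)`, which is where `κ < 1` enters.
  have hzstrict : ∀ b : S2, (b : E3) ∈ polarCone C → κ * ‖z‖ < inner ℝ z (b : E3) := by
    intro b hb
    set δ := min ε (‖z‖ / 2) with hδ
    have hzn := norm_pos_iff.2 hz0
    have hδ0 : 0 < δ := lt_min hε (by positivity)
    have hδε : δ ≤ ε := min_le_left _ _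
    have hδz : δ ≤ ‖z‖ / 2 := min_le_right _ _
    have htri : ‖z‖ - δ ≤ ‖z - δ • (b : E3)‖ := by
      have := norm_sub_norm_le z (δ • (b : E3))
      rwa [norm_smul, norm_coe_S2, mul_one, Real.norm_of_nonneg hδ0.le] at this
    have hmem : z - δ • (b : E3) ∈ polarCone C := by
      intro x hx
      rw [inner_sub_left, inner_smul_left, RCLike.conj_to_real]
      nlinarith [hle x hx, inner_le_one_S2 b x]
    have := hunit _ (norm_pos_iff.1 (by linarith)) b hmem hb
    rw [inner_sub_left, inner_smul_left, inner_self_S2, RCLike.conj_to_real] at this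
    nlinarith
  by_contra hpP
  -- The segment from `z` to `p` exits at `q`. As `t < 1`, `q` inherits the strict bound from `z`,
  -- whereas `hbd` gives a dual point violating it.
  obtain ⟨t, ht0, ht1, hmem, hx⟩ := exists_boundary_of_notMem_polarCone hC hzP hpP
  set q := z + t • ((p : E3) - z) with hq
  have hqe : q = (1 - t) • z + t • (p : E3) := by
    rw [hq, smul_sub, sub_smul, one_smul]; abel
  have hqstrict : ∀ b : S2, (b : E3) ∈ polarCone C → κ * ‖q‖ < inner ℝ q (b : E3) := by
    intro b hb
    have h1 := hzstrict b hb
    have h2 := hp b hb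
    have h3 : ‖q‖ ≤ (1 - t) * ‖z‖ + t := by
      rw [hqe]
      refine (norm_add_le _ _).trans_eq ?_
      rw [norm_smul, norm_smul, norm_coe_S2, mul_one, Real.norm_of_nonneg ht0,
        Real.norm_of_nonneg (by linarith)]
    have h4 : inner ℝ q (b : E3) = (1 - t) * inner ℝ z (b : E3) + t * inner ℝ (p : E3) (b : E3) := by
      rw [hqe, inner_add_left, inner_smul_left, inner_smul_left]; rfl
    rw [h4]
    nlinarith [mul_le_mul_of_nonneg_left h3 hκ0, mul_lt_mul_of_pos_left h1 (sub_pos.2 ht1),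
      mul_le_mul_of_nonneg_left h2 ht0]
  have hq0 : q ≠ 0 := by
    intro h0
    have := hqstrict ⟨‖z‖⁻¹ • z, by
      rw [mem_sphere_zero_iff_norm]; exact norm_smul_inv_norm hz0⟩ (fun x hx => by
        simp only [inner_smul_left]
        exact mul_nonneg (inv_nonneg.2 (norm_nonneg _)) (hzP x hx))
    rw [h0, norm_zero, inner_zero_left, mul_zero] at this
    exact lt_irrefl _ this
  have hqn := norm_pos_iff.2 hq0
  obtain ⟨x, hxC, hx0⟩ := hx
  obtain ⟨b, hb, hbκ⟩ := hbd ⟨‖q‖⁻¹ • q, by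
      rw [mem_sphere_zero_iff_norm]; exact norm_smul_inv_norm hq0⟩ (fun y hy => by
        simp only [inner_smul_left]
        exact mul_nonneg (inv_nonneg.2 (norm_nonneg _)) (hmem y hy))
    ⟨x, hxC, by simp only [inner_smul_left, hx0, mul_zero]⟩
  simp only [inner_smul_left, RCLike.conj_to_real] at hbκ
  rw [inv_mul_eq_div, div_le_iff₀ hqn] at hbκ
  linarith [hqstrict b hb]

lemma exists_inner_pos_of_interior_nonempty {C : Set S2} (hint : (interior C).Nonempty) {k : S2}
    (hk : (k : E3) ∈ polarCone C) : ∃ y ∈ C, 0 < inner ℝ (k : E3) (y : E3) := by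
  obtain ⟨y, hy⟩ := hint
  have hsub : C ⊆ hemisphere k := fun x hx => mem_hemisphere.2 (hk x hx)
  exact ⟨y, interior_subset hy, lt_of_le_of_ne (hk y (interior_subset hy)) fun h =>
    notMem_interior_hemisphere h.symm (interior_mono hsub hy)⟩

/-! ### Constant width read on the dual -/

/-- The thicknesses of the lunes that `H(k)` forms with the hemispheres supporting `C`. -/
def luneThicknesses (k : S2) (C : Set S2) : Set ℝ :=
  {t | ∃ k' : S2, Supports k' C ∧ IsLuneThickness k k' t}

lemma bddBelow_luneThicknesses (k : S2) (C : Set S2) : BddBelow (luneThicknesses k C) := by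
  refine ⟨0, ?_⟩
  rintro t ⟨k', -, -, -, c, c', -, -, rfl⟩
  exact InnerProductGeometry.angle_nonneg _ _

section ConstantWidth

variable {W : Set S2}

/-- By the convention `sInf ∅ = 0`, a set without supporting hemispheres has thickness `0`. -/
lemma exists_supports_of_thickness_pos (h : 0 < thickness W) : ∃ k : S2, Supports k W := by
  by_contra! hno
  have : {w | ∃ k : S2, Supports k W ∧ w = width k W} = ∅ := by
    ext w; simp [hno]
  rw [thickness, this, Real.sInf_empty] at h
  exact lt_irrefl _ h

lemma IsOfConstantWidth.width_eq (hW : IsOfConstantWidth W) {k : S2} (hk : Supports k W) :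
    width k W = thickness W := by
  have : {w | ∃ k : S2, Supports k W ∧ w = width k W} = {width k W} := by
    ext w
    constructor
    · rintro ⟨k', hk', rfl⟩
      exact hW.2 k' k hk' hk
    · rintro rfl
      exact ⟨k, hk, rfl⟩
  rw [thickness, this, csInf_singleton]

lemma IsOfConstantWidth.luneThicknesses_nonempty (hW : IsOfConstantWidth W)
    (h : 0 < thickness W) {k : S2} (hk : Supports k W) : (luneThicknesses k W).Nonempty := by
  by_contra hno
  have := hW.width_eq hk
  change sInf (luneThicknesses k W) = _ at this
  rw [Set.not_nonempty_iff_eq_empty.1 hno, Real.sInf_empty] at this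
  exact h.ne this

lemma IsOfConstantWidth.thickness_lt_pi (hW : IsOfConstantWidth W) (h : 0 < thickness W) :
    thickness W < Real.pi := by
  obtain ⟨k, hk⟩ := exists_supports_of_thickness_pos h
  obtain ⟨t, ht⟩ := hW.luneThicknesses_nonempty h hk
  have hle : thickness W ≤ t := by
    rw [← hW.width_eq hk]
    exact csInf_le (bddBelow_luneThicknesses k W) ht
  obtain ⟨k', -, hlune⟩ := ht
  obtain ⟨hne, -, rfl⟩ := isLuneThickness_iff.1 hlune
  have hpos : 0 < sdist k k' := by
    rw [sdist_eq_arccos, Real.arccos_pos]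
    exact lt_of_le_of_ne (inner_le_one_S2 k k') fun h' => hne (Subtype.ext
      ((inner_eq_one_iff_of_norm_eq_one (norm_coe_S2 k) (norm_coe_S2 k')).1 h')).symm
  linarith

lemma IsOfConstantWidth.neg_cos_le_inner_of_supports (hW : IsOfConstantWidth W)
    (h : 0 < thickness W) {k k' : S2} (hk : Supports k W) (hk' : Supports k' W) :
    -Real.cos (thickness W) ≤ inner ℝ (k : E3) (k' : E3) := by
  have hpi := hW.thickness_lt_pi h
  have hkP := ((supports_iff hW.1.1).1 hk).1
  have hkP' := ((supports_iff hW.1.1).1 hk').1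
  by_cases h1 : k' = k
  · rw [h1, inner_self_S2]
    linarith [Real.neg_one_le_cos (thickness W)]
  by_cases h2 : k' = -k
  -- Opposite supporting hemispheres would confine `W` to a great circle, which has empty interior.
  · obtain ⟨y, hy, hpos⟩ := exists_inner_pos_of_interior_nonempty hW.1.2.2 hkP
    have := hkP' y hy
    rw [h2, show ((-k : S2) : E3) = -(k : E3) from rfl, inner_neg_left] at this
    linarith
  have hle : thickness W ≤ Real.pi - sdist k k' := by
    rw [← hW.width_eq hk]
    exact csInf_le (bddBelow_luneThicknesses k W)
      ⟨k', hk', isLuneThickness_iff.2 ⟨h1, h2, rfl⟩⟩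
  rw [sdist_eq_arccos] at hle
  rw [← Real.cos_pi_sub, ← Real.cos_arccos (neg_one_le_inner_S2 k k') (inner_le_one_S2 k k')]
  exact Real.cos_le_cos_of_nonneg_of_le_pi (Real.arccos_nonneg _) (by linarith) (by linarith)

lemma isClosed_setOf_mem_polarCone (C : Set S2) : IsClosed {b : S2 | (b : E3) ∈ polarCone C} := by
  have : {b : S2 | (b : E3) ∈ polarCone C} =
      ⋂ x ∈ C, {b : S2 | 0 ≤ inner ℝ (b : E3) (x : E3)} := by
    ext v; simp [polarCone]
  rw [this]
  exact isClosed_biInter fun x _ => isClosed_le continuous_const (by fun_prop)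

/-- Every boundary point of the dual has a point of the dual at the maximal distance. -/
lemma IsOfConstantWidth.exists_inner_le_neg_cos (hW : IsOfConstantWidth W)
    (h : 0 < thickness W) {k : S2} (hk : Supports k W) :
    ∃ b : S2, (b : E3) ∈ polarCone W ∧
      inner ℝ (k : E3) (b : E3) ≤ -Real.cos (thickness W) := by
  have hpi := hW.thickness_lt_pi h
  obtain ⟨b, hb, hmin⟩ := (isClosed_setOf_mem_polarCone W).isCompact.exists_isMinOn
    ⟨k, ((supports_iff hW.1.1).1 hk).1⟩ (f := fun b : S2 => inner ℝ (k : E3) (b : E3))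
    (by fun_prop)
  refine ⟨b, hb, ?_⟩
  by_contra! hlt
  have harc : Real.arccos (inner ℝ (k : E3) (b : E3)) < Real.pi - thickness W := by
    have := Real.arccos_lt_arccos (by linarith [Real.cos_le_one (thickness W)]) hlt
      (inner_le_one_S2 k b)
    rwa [Real.arccos_neg, Real.arccos_cos h.le hpi.le] at this
  have hwidth := hW.width_eq hk
  obtain ⟨t, ⟨k', hk', hlune⟩, ht⟩ := exists_lt_of_csInf_lt (hW.luneThicknesses_nonempty h hk)
    (show sInf (luneThicknesses k W) < Real.pi - Real.arccos (inner ℝ (k : E3) (b : E3)) by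
      change width k W < _
      linarith)
  obtain ⟨-, -, rfl⟩ := isLuneThickness_iff.1 hlune
  rw [sdist_eq_arccos] at ht
  have := Real.arccos_le_arccos (hmin (show k' ∈ {b : S2 | (b : E3) ∈ polarCone W} from
    ((supports_iff hW.1.1).1 hk').1))
  simp only at this
  linarith

/-- The dual of a body of constant width at least `π / 2` has diameter `π - Δ`. -/
lemma IsOfConstantWidth.neg_cos_le_inner (hW : IsOfConstantWidth W)
    (h : Real.pi / 2 ≤ thickness W) {k k' : S2} (hk : (k : E3) ∈ polarCone W)
    (hk' : (k' : E3) ∈ polarCone W) :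
    -Real.cos (thickness W) ≤ inner ℝ (k : E3) (k' : E3) := by
  have h0 : 0 < thickness W := by linarith [Real.pi_pos]
  have hpi := hW.thickness_lt_pi h0
  have hκ0 : 0 ≤ -Real.cos (thickness W) := by
    linarith [Real.cos_nonpos_of_pi_div_two_le_of_le h (by linarith)]
  have hκ1 : -Real.cos (thickness W) ≤ 1 := by linarith [Real.neg_one_le_cos (thickness W)]
  have hC := hW.1.1.isCompact
  have hint := hW.1.2.2
  have hunit : ∀ y : S2, (∀ a : S2, Supports a W →
      -Real.cos (thickness W) ≤ inner ℝ (a : E3) (y : E3)) →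
      ∀ a ∈ polarCone W, (∃ x ∈ W, inner ℝ a (x : E3) = 0) →
        -Real.cos (thickness W) * ‖a‖ ≤ inner ℝ a (y : E3) := by
    rintro y hy a ha ⟨x, hx, hx0⟩
    rcases eq_or_ne a 0 with rfl | ha0
    · simp
    have hn := norm_pos_iff.2 ha0
    have := hy ⟨‖a‖⁻¹ • a, by rw [mem_sphere_zero_iff_norm]; exact norm_smul_inv_norm ha0⟩
      ((supports_iff hW.1.1).2 ⟨fun x hx => by
        simp only [inner_smul_left]
        exact mul_nonneg (inv_nonneg.2 hn.le) (ha x hx),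
        x, hx, by simp only [inner_smul_left, hx0, mul_zero]⟩)
    simp only [inner_smul_left, RCLike.conj_to_real] at this
    rwa [inv_mul_eq_div, le_div_iff₀ hn] at this
  have hext : ∀ y : S2, (y : E3) ∈ polarCone W → (∀ a : S2, Supports a W →
      -Real.cos (thickness W) ≤ inner ℝ (a : E3) (y : E3)) →
      ∀ z : S2, (z : E3) ∈ polarCone W →
        -Real.cos (thickness W) ≤ inner ℝ (z : E3) (y : E3) := by
    intro y hyP hy z hz
    have := mul_norm_le_inner_of_boundary hC hκ0 hκ1
      (exists_inner_pos_of_interior_nonempty hint hyP) (hunit y hy) hz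
    rwa [norm_coe_S2, mul_one] at this
  -- The bound spreads from the boundary to the whole dual one variable at a time.
  refine hext k' hk' (fun a ha => ?_) k hk
  rw [real_inner_comm]
  exact hext a ((supports_iff hW.1.1).1 ha).1
    (fun b hb => hW.neg_cos_le_inner_of_supports h0 hb ha) k' hk'

/-! ### Trigonometry of the radius -/

lemma cos_arcsin_two_sqrt_three_div (w : ℝ) :
    Real.cos (Real.arcsin (2 * √3 / 3 * Real.cos (w / 2))) = √((1 + 2 * -Real.cos w) / 3) := by
  rw [Real.cos_arcsin]
  congr 1
  have h1 : Real.cos w = 2 * Real.cos (w / 2) ^ 2 - 1 := by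
    rw [← Real.cos_two_mul]; ring_nf
  have h3 : √3 ^ 2 = (3 : ℝ) := Real.sq_sqrt (by norm_num)
  rw [mul_pow, div_pow, mul_pow, h3, h1]
  ring

/-- Makes the radius `π - w - r` of the disk inside the dual nonnegative. After taking sines it
reduces to `√3 / 3 ≤ sin (w / 2)`, clear since `w ≥ π / 2` gives `sin² (w / 2) ≥ 1 / 2`. -/
lemma arcsin_two_sqrt_three_div_le {w : ℝ} (h : Real.pi / 2 ≤ w) (hpi : w < Real.pi) :
    Real.arcsin (2 * √3 / 3 * Real.cos (w / 2)) ≤ Real.pi - w := by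
  rw [← Real.arcsin_sin (x := Real.pi - w) (by linarith) (by linarith), Real.sin_pi_sub]
  refine Real.monotone_arcsin ?_
  have hcos : 0 < Real.cos (w / 2) := Real.cos_pos_of_mem_Ioo ⟨by linarith, by linarith⟩
  have hsin : 0 < Real.sin (w / 2) := Real.sin_pos_of_pos_of_lt_pi (by linarith) (by linarith)
  have hw : Real.cos w ≤ 0 := Real.cos_nonpos_of_pi_div_two_le_of_le h (by linarith)
  have hd : Real.sin w = 2 * Real.sin (w / 2) * Real.cos (w / 2) := by
    rw [← Real.sin_two_mul]; ring_nf
  have hc : Real.cos w = 2 * Real.cos (w / 2) ^ 2 - 1 := by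
    rw [← Real.cos_two_mul]; ring_nf
  have hle : √3 / 3 ≤ Real.sin (w / 2) := by
    refine (sq_le_sq₀ (by positivity) hsin.le).1 ?_
    rw [div_pow, Real.sq_sqrt (by norm_num)]
    nlinarith [Real.sin_sq_add_cos_sq (w / 2)]
  rw [hd]
  nlinarith

end ConstantWidth

/-! ### From the dual back to the body -/

/-- If the dual cone contains the disk of radius `η < π / 2` around `c`, then `C` lies in the disk
of radius `π / 2 - η` around `c`. -/
lemma subset_ball_of_ball_subset_polarCone {C : Set S2} {c : S2} {η : ℝ} (hη0 : 0 ≤ η)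
    (hη : η < Real.pi / 2) (h : ∀ p : S2, sdist c p ≤ η → (p : E3) ∈ polarCone C) :
    C ⊆ ball c (Real.pi / 2 - η) := by
  intro x hx
  change sdist c x ≤ _
  by_cases h1 : x = c
  · rw [h1, sdist_eq_arccos, inner_self_S2, Real.arccos_one]
    linarith
  by_cases h2 : x = -c
  · have := h c (by rwa [sdist_eq_arccos, inner_self_S2, Real.arccos_one]) x hx
    rw [h2, show ((-c : S2) : E3) = -(c : E3) from rfl, inner_neg_right, inner_self_S2] at this
    linarith
  have hcu := inner_normalizedProj_self h1 h2
  set u := normalizedProj c x h1 h2 with hu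
  have huc : inner ℝ (u : E3) (c : E3) = 0 := by rw [real_inner_comm]; exact hcu
  have hux : inner ℝ (u : E3) (x : E3) = Real.sin (sdist c x) := by
    have hpos := inner_sq_lt_one h1 h2
    rw [sdist_eq_arccos, Real.sin_arccos, hu]
    simp only [normalizedProj, inner_smul_left, inner_sub_left, inner_self_S2, RCLike.conj_to_real]
    rw [inv_mul_eq_div, ← pow_two, Real.div_sqrt]
  have hcx : inner ℝ (c : E3) (x : E3) = Real.cos (sdist c x) := by
    rw [sdist_eq_arccos, Real.cos_arccos (neg_one_le_inner_S2 c x) (inner_le_one_S2 c x)]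
  -- The dual point at distance `η` from `c` directly away from `x`; its inner product with `x` is
  -- `cos (η + |cx|)`, so `η + |cx| ≤ π / 2`.
  have hp : sdist c (rotateAway c u huc η) ≤ η := by
    rw [sdist_eq_arccos]
    simp only [rotateAway, inner_sub_right, inner_smul_right, inner_self_S2, hcu]
    rw [mul_one, mul_zero, sub_zero, Real.arccos_cos hη0 (by linarith [Real.pi_pos])]
  have hpx := h _ hp x hx
  simp only [rotateAway, inner_sub_left, inner_smul_left, hux, hcx, RCLike.conj_to_real] at hpx
  rw [← Real.cos_add] at hpx
  by_contra! hlt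
  have hle : sdist c x ≤ Real.pi := InnerProductGeometry.angle_le_pi _ _
  have := Real.cos_neg_of_pi_div_two_lt_of_lt (x := η + sdist c x) (by linarith) (by linarith)
  linarith

end SphericalBody

open SphericalBody

theorem mainTheorem11 (W : Set SphericalBody.S2)
    (hW : SphericalBody.IsOfConstantWidth W)
    (hwidth : Real.pi / 2 ≤ SphericalBody.thickness W) :
    ∃ D : Set SphericalBody.S2,
      SphericalBody.IsDisk D
        (SphericalBody.thickness W
          + Real.arcsin (2 * √3 / 3 * Real.cos (SphericalBody.thickness W / 2))
          - Real.pi / 2) ∧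
      W ⊆ D := by
  have h0 : 0 < thickness W := by linarith [Real.pi_pos]
  have hpi := hW.thickness_lt_pi h0
  have hrle := arcsin_two_sqrt_three_div_le hwidth hpi
  have hcosr := cos_arcsin_two_sqrt_three_div (thickness W)
  have hr0 : 0 < Real.arcsin (2 * √3 / 3 * Real.cos (thickness W / 2)) := by
    have : 0 < Real.cos (thickness W / 2) :=
      Real.cos_pos_of_mem_Ioo ⟨by linarith, by linarith⟩
    exact Real.arcsin_pos.2 (by positivity)
  set r := Real.arcsin (2 * √3 / 3 * Real.cos (thickness W / 2)) with hr
  obtain ⟨k, hk⟩ := exists_supports_of_thickness_pos h0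
  have hκ0 : 0 ≤ -Real.cos (thickness W) := by
    linarith [Real.cos_nonpos_of_pi_div_two_le_of_le hwidth (by linarith)]
  have hκ1 : -Real.cos (thickness W) < 1 := by
    have := Real.cos_lt_cos_of_nonneg_of_le_pi h0.le le_rfl hpi
    rw [Real.cos_pi] at this
    linarith
  obtain ⟨c, hc⟩ := spherical_jung (isClosed_setOf_mem_polarCone W)
    ⟨k, ((supports_iff hW.1.1).1 hk).1⟩ hκ0 fun x hx y hy => hW.neg_cos_le_inner hwidth hx hy
  rw [← hcosr] at hc
  refine ⟨ball c (thickness W + r - Real.pi / 2), ⟨by linarith, by linarith, c, rfl⟩, ?_⟩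
  rw [show thickness W + r - Real.pi / 2 = Real.pi / 2 - (Real.pi - thickness W - r) by ring]
  refine subset_ball_of_ball_subset_polarCone (by linarith) (by linarith) fun p hp => ?_
  refine mem_polarCone_of_forall_le_inner hW.1.1.isCompact hW.1.2.1
    (hW.1.2.2.mono interior_subset) hκ0 hκ1 (fun x y hx hy => hW.neg_cos_le_inner hwidth hx hy)
    (fun q hq hq' => hW.exists_inner_le_neg_cos h0 ((supports_iff hW.1.1).2 ⟨hq, hq'⟩))
    fun x hx => ?_
  have hcx : sdist c x ≤ r := by
    rw [sdist_eq_arccos, ← Real.arccos_cos hr0.le (by linarith)]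
    exact Real.arccos_le_arccos (hc x hx)
  have htri : sdist p x ≤ sdist p c + sdist c x :=
    InnerProductGeometry.angle_le_angle_add_angle _ _ _
  have hsymm : sdist p c = sdist c p := InnerProductGeometry.angle_comm _ _
  -- Here `|px| ≤ (π - w - r) + r = π - w`, as completeness requires.
  rw [← Real.cos_pi_sub, ← Real.cos_arccos (neg_one_le_inner_S2 p x) (inner_le_one_S2 p x),
    ← sdist_eq_arccos]
  exact Real.cos_le_cos_of_nonneg_of_le_pi (InnerProductGeometry.angle_nonneg _ _) (by linarith)
    (by linarith)
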